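/- For a partition $\pi$ of a nonnegative integer $n$, the \emph{rank} of $\pi$ is its largest part minus its number of parts. The \emph{crank} of $\pi$ is the largest part of $\pi$ if $\pi$ has no part equal to $1$; if $\pi$ has $\omega\ge 1$ parts equal to $1$, the crank is the number of parts of $\pi$ larger than $\omega$, minus $\omega$. Let $N(m,n)$ be the number of partitions of $n$ with rank $m$, and, for $n\neq 1$, let $M(m,n)$ be the number of partitions of $n$ with crank $m$; for $n=1$ put $M(-1,1)=M(1,1)=1$, $M(0,1)=-1$, and $M(m,1)=0$ for all other $m$. For $j\ge 0$ define the $j$-th rank moment and the $j$-th crank moment by $$N_j(n)=\sum_{m=-n}^{n} m^j N(m,n),\qquad M_j(n)=\sum_{m=-n}^{n} m^j M(m,n).$$ Then for all integers $k\ge 1$ and $n\ge 1$ (in particular whenever $1\le k\le n$), $$M_{2k}(n)>N_{2k}(n).$$ -/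

import Mathlib

namespace PartitionMoments

/-- Dyson's rank of a partition: the largest part minus the number of parts. -/
def rank {n : ℕ} (p : n.Partition) : ℤ :=
  (p.parts.sup : ℤ) - (Multiset.card p.parts : ℤ)

/-- The Andrews–Garvan crank of a partition. Let `ω` be the number of ones. If `ω = 0`, the crank is
the largest part; otherwise it is the number of parts larger than `ω`, minus `ω`. -/
def crank {n : ℕ} (p : n.Partition) : ℤ :=
  if p.parts.count 1 = 0 then (p.parts.sup : ℤ)
  else (p.parts.countP (fun i => p.parts.count 1 < i) : ℤ) - (p.parts.count 1 : ℤ)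

/-- `N(m, n)`: the number of partitions of `n` with rank `m`. -/
def rankCount (m : ℤ) (n : ℕ) : ℤ :=
  ((Finset.univ.filter fun p : n.Partition => rank p = m).card : ℤ)

/-- `M(m, n)`: the number of partitions of `n` with crank `m` for `n ≠ 1`, with the usual
convention `M(-1, 1) = M(1, 1) = 1`, `M(0, 1) = -1` and `M(m, 1) = 0` otherwise. -/
def crankCount (m : ℤ) (n : ℕ) : ℤ :=
  if n = 1 then
    if m = -1 ∨ m = 1 then 1 else if m = 0 then -1 else 0
  else ((Finset.univ.filter fun p : n.Partition => crank p = m).card : ℤ)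

/-- The `j`-th rank moment `N_j(n) = ∑_{m=-n}^{n} m^j N(m, n)`. -/
noncomputable def rankMoment (j n : ℕ) : ℤ :=
  ∑ m ∈ Finset.Icc (-(n : ℤ)) (n : ℤ), m ^ j * rankCount m n

/-- The `j`-th crank moment `M_j(n) = ∑_{m=-n}^{n} m^j M(m, n)`. -/
noncomputable def crankMoment (j n : ℕ) : ℤ :=
  ∑ m ∈ Finset.Icc (-(n : ℤ)) (n : ℤ), m ^ j * crankCount m n

end PartitionMoments

/-!
Write `w = z⁻¹`. Clearing the denominators `(z q)_M (w q)_M` turns the generating functions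
`R = ∑ z^rank q^n` and `C = ∑ z^crank q^n` into finite sums satisfying the same recursion, and
gives `C - R = (z + w - 2) S`, where `S = ∑ q^m (q^{m+1})_∞ / ((z q^m)_∞ (w q^m)_∞)` is the
spt-crank series of Andrews, Garvan and Liang. All identities are proved modulo `q^{n+1}`, where
they involve only finite sums and products.

Put `z = e^t`, so that the coefficient of `t^{2k}` in `∑ z^rank` and `∑ z^crank` is the moment
divided by `(2k)!`. As `z + w - 2 = 2 (cosh t - 1)` has nonnegative coefficients, and
`(1 - x) / ((1 - z x) (1 - w x)) = 1 / (1 - f)` with `f = x + (z + w - 2) x / (1 - x)`,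
every `q`-coefficient of `S` has nonnegative coefficients in `t` and constant term at least `1`.
Hence `M_{2k}(n) - N_{2k}(n)` is at least `(2k)!` times the coefficient `2 / (2k)!` of `t^{2k}`
in `z + w - 2`.
-/

namespace PartitionMoments

open Finset PowerSeries
open scoped Ring

section General

lemma map_ringInverse {M N F : Type*} [MonoidWithZero M] [MonoidWithZero N] [FunLike F M N]
    [MonoidHomClass F M N] (φ : F) {x : M} (hx : IsUnit x) : φ x⁻¹ʳ = (φ x)⁻¹ʳ := by
  obtain ⟨u, rfl⟩ := hx
  rw [Ring.inverse_unit]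
  exact (Ring.inverse_unit (Units.map (φ : M →* N) u)).symm

lemma prod_map_ite_eq_pow_countP {ι M : Type*} [CommMonoid M] (P : ι → Prop) [DecidablePred P]
    (z : M) (m : Multiset ι) :
    (m.map fun i => if P i then z else 1).prod = z ^ m.countP P := by
  induction m using Multiset.induction_on with
  | empty => simp
  | cons i m ih =>
    rw [Multiset.map_cons, Multiset.prod_cons, ih, Multiset.countP_cons]
    split_ifs <;> simp [pow_succ']

lemma prod_sub_one_mem {ι R : Type*} [CommRing R] {T : Subsemiring R} {f : ι → R} {s : Finset ι}
    (hf : ∀ i ∈ s, f i - 1 ∈ T) : ∏ i ∈ s, f i - 1 ∈ T := by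
  refine prod_induction f (fun x => x - 1 ∈ T) (fun x y hx hy => ?_) ?_ hf
  · rw [show x * y - 1 = (x - 1) * (y - 1) + (x - 1) + (y - 1) by ring]
    exact add_mem (add_mem (mul_mem hx hy) hx) hy
  · rw [sub_self]
    exact zero_mem T

lemma sup_mem_of_sup_ne_bot {α : Type*} [LinearOrder α] [OrderBot α] {m : Multiset α}
    (hm : m.sup ≠ ⊥) : m.sup ∈ m := by
  induction m using Multiset.induction_on with
  | empty => exact absurd Multiset.sup_zero hm
  | cons a m ih =>
    rw [Multiset.sup_cons] at hm ⊢
    rcases le_total m.sup a with h | h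
    · rw [sup_eq_left.2 h]
      exact Multiset.mem_cons_self a m
    · rw [sup_eq_right.2 h] at hm ⊢
      exact Multiset.mem_cons_of_mem (ih hm)

lemma sup_eq_iff_mem_and_forall_le {α : Type*} [LinearOrder α] [OrderBot α] {m : Multiset α}
    {N : α} (hN : N ≠ ⊥) : m.sup = N ↔ N ∈ m ∧ ∀ i ∈ m, i ≤ N := by
  constructor
  · rintro rfl
    exact ⟨sup_mem_of_sup_ne_bot hN, fun _ => Multiset.le_sup⟩
  · rintro ⟨hmem, hle⟩
    exact le_antisymm (Multiset.sup_le.2 hle) (Multiset.le_sup hmem)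

lemma sum_pow_mul_card_fiber {α : Type*} [Fintype α] {r : α → ℤ} {t : Finset ℤ}
    (hr : ∀ a, r a ∈ t) (j : ℕ) :
    ∑ m ∈ t, m ^ j * (#{a | r a = m} : ℤ) = ∑ a, r a ^ j := by
  rw [← sum_fiberwise_of_maps_to (t := t) fun a _ => hr a]
  refine sum_congr rfl fun m _ => ?_
  rw [sum_congr rfl (g := fun _ => m ^ j) fun a ha => by rw [(mem_filter.1 ha).2], sum_const,
    nsmul_eq_mul, mul_comm]

end General

section QSeries

variable {B B' : Type*} [CommRing B] [CommRing B']

/-- The finite `q`-Pochhammer symbol `(a; q)_n`. -/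
def qPoch (a q : B) (n : ℕ) : B := ∏ i ∈ range n, (1 - a * q ^ i)

@[simp] lemma qPoch_zero (a q : B) : qPoch a q 0 = 1 := by simp [qPoch]

@[simp] lemma qPoch_zero_left (q : B) (n : ℕ) : qPoch 0 q n = 1 := by simp [qPoch]

lemma qPoch_succ (a q : B) (n : ℕ) : qPoch a q (n + 1) = qPoch a q n * (1 - a * q ^ n) :=
  prod_range_succ _ n

lemma qPoch_add (a q : B) (m n : ℕ) :
    qPoch a q (m + n) = qPoch a q m * qPoch (a * q ^ m) q n := by
  simp only [qPoch, prod_range_add, pow_add, mul_assoc]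

lemma qPoch_succ' (a q : B) (n : ℕ) : qPoch a q (n + 1) = (1 - a) * qPoch (a * q) q n := by
  rw [add_comm, qPoch_add, qPoch_succ]
  simp

lemma qPoch_add_of_mul_pow_eq_zero {a q : B} {m : ℕ} (h : a * q ^ m = 0) (n : ℕ) :
    qPoch a q (m + n) = qPoch a q m := by
  rw [qPoch_add, h, qPoch_zero_left, mul_one]

lemma isUnit_qPoch_of_isNilpotent {a : B} (ha : IsNilpotent a) (q : B) (n : ℕ) :
    IsUnit (qPoch a q n) := by
  induction n with
  | zero => simp
  | succ n ih =>
    rw [qPoch_succ]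
    exact ih.mul ((Commute.all _ _).isNilpotent_mul_right ha).isUnit_one_sub

lemma map_qPoch (φ : B →+* B') (a q : B) (n : ℕ) : φ (qPoch a q n) = qPoch (φ a) (φ q) n := by
  simp [qPoch]

lemma one_sub_mul_inverse_qPoch_succ {q : B} (hq : IsUnit (1 - q)) (n : ℕ) :
    (1 - q) * (qPoch q q (n + 1))⁻¹ʳ = (qPoch (q ^ 2) q n)⁻¹ʳ := by
  rw [qPoch_succ', Ring.inverse_mul (Or.inl hq), mul_left_comm, Ring.mul_inverse_cancel _ hq,
    mul_one, sq]

lemma inverse_qPoch_mul_qPoch {a q : B} {j n : ℕ} (hunit : IsUnit (qPoch a q j)) (hjn : j ≤ n) :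
    (qPoch a q n)⁻¹ʳ * qPoch a q j = (qPoch (a * q ^ j) q (n - j))⁻¹ʳ := by
  rw [← Nat.add_sub_cancel' hjn, qPoch_add, Ring.inverse_mul (Or.inl hunit), mul_assoc,
    Ring.inverse_mul_cancel _ hunit, mul_one, Nat.add_sub_cancel_left]

/-- The sum `∑_{n ≤ M} (a)_n (b)_n q^n (q^{n+1})_{M-n}`: the truncated Heine series
`₂φ₁(a, b; 0; q, q)`, multiplied by `(q)_M`. -/
def heineSum (a b q : B) (M : ℕ) : B :=
  ∑ n ∈ range (M + 1), qPoch a q n * qPoch b q n * q ^ n * qPoch (q ^ (n + 1)) q (M - n)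

lemma heineSum_zero (a b q : B) : heineSum a b q 0 = 1 := by simp [heineSum]

lemma heineSum_succ (a b q : B) (M : ℕ) :
    heineSum a b q (M + 1) = (1 - q ^ (M + 1)) * heineSum a b q M +
      qPoch a q (M + 1) * qPoch b q (M + 1) * q ^ (M + 1) := by
  rw [heineSum, sum_range_succ, Nat.sub_self, qPoch_zero, mul_one, heineSum, mul_sum]
  congr 1
  refine sum_congr rfl fun n hn => ?_
  have hnM : n ≤ M := mem_range_succ_iff.1 hn
  rw [Nat.succ_sub hnM, qPoch_succ, ← pow_add, show n + 1 + (M - n) = M + 1 by omega]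
  ring

lemma heineSum_zero_right (a q : B) (M : ℕ) : heineSum a 0 q M = qPoch (a * q) q M := by
  induction M with
  | zero => simp [heineSum_zero]
  | succ M ih =>
    rw [heineSum_succ, ih, qPoch_zero_left, qPoch_succ' a, qPoch_succ]
    ring

lemma heineSum_sub_mul_heineSum (a b q : B) (M : ℕ) :
    heineSum a b q M - a * heineSum a (b * q) q M = qPoch a q (M + 1) * qPoch (b * q) q M := by
  induction M with
  | zero => simp [heineSum_zero, qPoch_succ]
  | succ M ih =>
    rw [heineSum_succ, heineSum_succ, qPoch_succ' b, qPoch_succ (b * q), qPoch_succ a q (M + 1)]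
    linear_combination (1 - q ^ (M + 1)) * ih

lemma heineSum_eq_sum_add (a b q : B) (M J : ℕ) :
    heineSum a b q M = qPoch a q (M + 1) * ∑ j ∈ range J, a ^ j * qPoch (b * q ^ (j + 1)) q M +
      a ^ J * heineSum a (b * q ^ J) q M := by
  induction J with
  | zero => simp
  | succ J ih =>
    have h := heineSum_sub_mul_heineSum a (b * q ^ J) q M
    rw [mul_assoc b, ← pow_succ] at h
    rw [ih, sum_range_succ]
    linear_combination a ^ J * h

/-- The generating function `1 + ∑ z^j q^{j+1} / (w q; q)_{j+1}` of the rank, with `w = z⁻¹`,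
truncated to partitions with parts at most `M`. -/
noncomputable def rankSeries (z w q : B) (M : ℕ) : B :=
  1 + ∑ j ∈ range M, z ^ j * q ^ (j + 1) * (qPoch (w * q) q (j + 1))⁻¹ʳ

lemma one_sub_mul_sum_add {z w q : B} (hzw : z * w = 1) {E : ℕ → B}
    (hE : ∀ j, E j = (1 - w * q ^ (j + 1)) * E (j + 1)) (N : ℕ) :
    (1 - z) * ∑ j ∈ range (N + 1), z ^ j * E j + z ^ (N + 1) * E N =
      E 0 + ∑ j ∈ range N, z ^ j * q ^ (j + 1) * E (j + 1) := by
  induction N with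
  | zero => simp only [zero_add, range_one, sum_singleton, range_zero, sum_empty]; ring
  | succ N ih =>
    rw [sum_range_succ, sum_range_succ (fun j => z ^ j * q ^ (j + 1) * E (j + 1))]
    linear_combination ih + (-z ^ (N + 1)) * hE N + z ^ N * q ^ (N + 1) * E (N + 1) * hzw

lemma qPoch_mul_qPoch_mul_pow {q : B} {M : ℕ} (hq : q ^ (M + 1) = 0) (w : B) (j : ℕ) :
    qPoch (w * q) q j * qPoch (w * q ^ (j + 1)) q M = qPoch (w * q) q M := by
  rw [pow_succ', ← mul_assoc, ← qPoch_add, add_comm,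
    qPoch_add_of_mul_pow_eq_zero (by rw [mul_assoc, ← pow_succ', hq, mul_zero])]

lemma isNilpotent_mul_of_pow_eq_zero {q : B} {M : ℕ} (hq : q ^ (M + 1) = 0) (w : B) :
    IsNilpotent (w * q) :=
  (Commute.all w q).isNilpotent_mul_left ⟨M + 1, hq⟩

lemma qPoch_mul_rankSeries {q : B} {M : ℕ} (hq : q ^ (M + 1) = 0) (z w : B) :
    qPoch (w * q) q M * rankSeries z w q M =
      qPoch (w * q) q M + ∑ j ∈ range M, z ^ j * q ^ (j + 1) * qPoch (w * q ^ (j + 2)) q M := by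
  rw [rankSeries, mul_add, mul_one, mul_sum]
  congr 1
  refine sum_congr rfl fun j _ => ?_
  have hunit := isUnit_qPoch_of_isNilpotent (isNilpotent_mul_of_pow_eq_zero hq w) q (j + 1)
  rw [← qPoch_mul_qPoch_mul_pow hq w (j + 1)]
  linear_combination (z ^ j * q ^ (j + 1) * qPoch (w * q ^ (j + 2)) q M) *
    Ring.mul_inverse_cancel _ hunit

theorem qPoch_mul_qPoch_mul_rankSeries {z w q : B} {M : ℕ} (hq : q ^ (M + 1) = 0)
    (hzw : z * w = 1) :
    qPoch (z * q) q M * (qPoch (w * q) q M * rankSeries z w q M) = heineSum z w q M := by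
  have hE (j : ℕ) : qPoch (w * q ^ (j + 1)) q M =
      (1 - w * q ^ (j + 1)) * qPoch (w * q ^ (j + 2)) q M := by
    have hzero : w * q ^ (j + 1) * q ^ M = 0 := by
      linear_combination (w * q ^ j) * hq
    rw [← qPoch_add_of_mul_pow_eq_zero hzero 1, qPoch_succ', mul_assoc w, ← pow_succ]
  have htel := one_sub_mul_sum_add hzw hE M
  have hEM : qPoch (w * q ^ (M + 1)) q M = 1 := by rw [hq, mul_zero, qPoch_zero_left]
  rw [hEM, mul_one, zero_add, pow_one] at htel
  rw [qPoch_mul_rankSeries hq, ← htel, heineSum_eq_sum_add z w q M (M + 1), hq, mul_zero,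
    heineSum_zero_right, qPoch_succ' z]
  ring

/-- The factor `(1 - q^m) / ((1 - z q^m) (1 - w q^m))`, with `m = i + 1`, of the crank generating
function. -/
noncomputable def crankFactor (z w q : B) (i : ℕ) : B :=
  (1 - q ^ (i + 1)) * ((1 - z * q ^ (i + 1)) * (1 - w * q ^ (i + 1)))⁻¹ʳ

/-- The generating function `∏ (1 - q^m) / ((1 - z q^m) (1 - w q^m))` of the crank, with
`w = z⁻¹`, truncated at `m ≤ M`. -/
noncomputable def crankSeries (z w q : B) (M : ℕ) : B := ∏ i ∈ range M, crankFactor z w q i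

/-- The generating function `∑ q^m (q^{m+1})_∞ / ((z q^m)_∞ (w q^m)_∞)` of Andrews, Garvan and
Liang's spt-crank, with `w = z⁻¹`, where every `m` is truncated at `M`. -/
noncomputable def sptSeries (z w q : B) (M : ℕ) : B :=
  ∑ i ∈ range M, q ^ (i + 1) * ((1 - z * q ^ (i + 1)) * (1 - w * q ^ (i + 1)))⁻¹ʳ *
    ∏ l ∈ Ico (i + 1) M, crankFactor z w q l

lemma sptSeries_succ (z w q : B) (M : ℕ) :
    sptSeries z w q (M + 1) = sptSeries z w q M * crankFactor z w q M +
      q ^ (M + 1) * ((1 - z * q ^ (M + 1)) * (1 - w * q ^ (M + 1)))⁻¹ʳ := by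
  rw [sptSeries, sum_range_succ, Ico_self, prod_empty, mul_one, sptSeries, sum_mul]
  congr 1
  refine sum_congr rfl fun i hi => ?_
  rw [prod_Ico_succ_top (mem_range.1 hi), ← mul_assoc]

theorem qPoch_mul_qPoch_mul_crankSeries_sub {z w q : B} (hzw : z * w = 1)
    (hunit : ∀ i, IsUnit ((1 - z * q ^ (i + 1)) * (1 - w * q ^ (i + 1)))) (M : ℕ) :
    qPoch (z * q) q M * (qPoch (w * q) q M *
      (crankSeries z w q M - (z + w - 2) * sptSeries z w q M)) = heineSum z w q M := by
  induction M with
  | zero => simp [crankSeries, sptSeries, heineSum_zero]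
  | succ M ih =>
    rw [heineSum_succ, ← ih, sptSeries_succ, crankSeries, prod_range_succ, ← crankSeries,
      qPoch_succ' z, qPoch_succ' w, qPoch_succ, qPoch_succ, crankFactor]
    linear_combination qPoch (z * q) q M * qPoch (w * q) q M *
      ((1 - q ^ (M + 1)) * (crankSeries z w q M - (z + w - 2) * sptSeries z w q M) -
        (z + w - 2) * q ^ (M + 1)) * Ring.mul_inverse_cancel _ (hunit M) -
      qPoch (z * q) q M * qPoch (w * q) q M * q ^ (M + 1) * hzw

lemma isUnit_one_sub_mul_one_sub {q : B} {M : ℕ} (hq : q ^ (M + 1) = 0) (z w : B) (i : ℕ) :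
    IsUnit ((1 - z * q ^ (i + 1)) * (1 - w * q ^ (i + 1))) := by
  have hunit (c : B) : IsUnit (1 - c * q ^ (i + 1)) :=
    ((Commute.all c _).isNilpotent_mul_left (IsNilpotent.pow_succ i ⟨M + 1, hq⟩)).isUnit_one_sub
  exact (hunit z).mul (hunit w)

theorem rankSeries_eq_crankSeries_sub {z w q : B} {M : ℕ} (hq : q ^ (M + 1) = 0)
    (hzw : z * w = 1) :
    rankSeries z w q M = crankSeries z w q M - (z + w - 2) * sptSeries z w q M := by
  have hunit (c : B) : IsUnit (qPoch (c * q) q M) :=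
    isUnit_qPoch_of_isNilpotent (isNilpotent_mul_of_pow_eq_zero hq c) q M
  refine (hunit w).mul_left_cancel ((hunit z).mul_left_cancel ?_)
  rw [qPoch_mul_qPoch_mul_rankSeries hq hzw,
    qPoch_mul_qPoch_mul_crankSeries_sub hzw (isUnit_one_sub_mul_one_sub hq z w)]

/-- The `q`-binomial series `∑ (c)_j t^j / (q)_j`, truncated at `j ≤ M`. -/
noncomputable def qBinomSeries (c t q : B) (M : ℕ) : B :=
  ∑ j ∈ range (M + 1), qPoch c q j * t ^ j * (qPoch q q j)⁻¹ʳ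

lemma qBinomSeries_zero_middle (c q : B) (M : ℕ) : qBinomSeries c 0 q M = 1 := by
  simp [qBinomSeries, sum_range_succ']

lemma one_sub_mul_qBinomSeries_sub {q : B} (hunit : ∀ n, IsUnit (qPoch q q n)) (c t : B) (M : ℕ) :
    (1 - t) * qBinomSeries c t q M - (1 - c * t) * qBinomSeries c (t * q) q M =
      -(qPoch c q (M + 1) * t ^ (M + 1) * (qPoch q q M)⁻¹ʳ) := by
  induction M with
  | zero => simp [qBinomSeries, qPoch_succ]; ring
  | succ M ih =>
    have hinv : (qPoch q q (M + 1))⁻¹ʳ * (1 - q ^ (M + 1)) = (qPoch q q M)⁻¹ʳ := by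
      have hlast : IsUnit (1 - q * q ^ M) :=
        isUnit_of_mul_isUnit_right (qPoch_succ q q M ▸ hunit (M + 1))
      rw [qPoch_succ, Ring.inverse_mul (Or.inl (hunit M)), pow_succ']
      linear_combination (qPoch q q M)⁻¹ʳ * Ring.inverse_mul_cancel _ hlast
    rw [qBinomSeries, sum_range_succ, qBinomSeries, sum_range_succ _ (M + 1), ← qBinomSeries,
      ← qBinomSeries, qPoch_succ c q (M + 1)]
    linear_combination ih + qPoch c q (M + 1) * t ^ (M + 1) * hinv

theorem qBinomSeries_mul_qPoch {q : B} {M : ℕ} (hq : q ^ (M + 1) = 0) (c w : B) :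
    qBinomSeries c (w * q) q M * qPoch (w * q) q M = qPoch (c * (w * q)) q M := by
  have hiter (n : ℕ) : qBinomSeries c (w * q) q M * qPoch (w * q) q n =
      qPoch (c * (w * q)) q n * qBinomSeries c (w * q ^ (n + 1)) q M := by
    induction n with
    | zero => simp
    | succ n ih =>
      have hstep := one_sub_mul_qBinomSeries_sub
        (isUnit_qPoch_of_isNilpotent ⟨M + 1, hq⟩ q) c (w * q ^ (n + 1)) M
      have hpow : (w * q ^ (n + 1)) ^ (M + 1) = 0 := by
        rw [mul_pow, pow_right_comm, hq, zero_pow n.succ_ne_zero, mul_zero]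
      rw [hpow, mul_assoc w, ← pow_succ] at hstep
      rw [qPoch_succ, qPoch_succ]
      linear_combination (1 - w * q * q ^ n) * ih + qPoch (c * (w * q)) q n * hstep
  rw [hiter, hq, mul_zero, qBinomSeries_zero_middle, mul_one]

theorem qBinomSeries_zero_left {q : B} {M : ℕ} (hq : q ^ (M + 1) = 0) (w : B) :
    qBinomSeries 0 (w * q) q M = (qPoch (w * q) q M)⁻¹ʳ := by
  have hunit := isUnit_qPoch_of_isNilpotent (isNilpotent_mul_of_pow_eq_zero hq w) q M
  rw [← one_mul (_⁻¹ʳ), Ring.eq_mul_inverse_iff_mul_eq _ _ _ hunit, qBinomSeries_mul_qPoch hq,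
    zero_mul, qPoch_zero_left]

lemma crankSeries_mul_qPoch_mul_qPoch {z w q : B}
    (hunit : ∀ i, IsUnit ((1 - z * q ^ (i + 1)) * (1 - w * q ^ (i + 1)))) (M : ℕ) :
    crankSeries z w q M * (qPoch (z * q) q M * qPoch (w * q) q M) = qPoch q q M := by
  simp only [crankSeries, qPoch, ← prod_mul_distrib]
  refine prod_congr rfl fun i _ => ?_
  rw [crankFactor, mul_assoc z, mul_assoc w, ← pow_succ',
    Ring.inverse_mul_cancel_right _ _ (hunit i)]

theorem crankSeries_eq_mul_qBinomSeries {z w q : B} {M : ℕ} (hq : q ^ (M + 1) = 0)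
    (hzw : z * w = 1) :
    crankSeries z w q M =
      (1 - q) * (qPoch (z * q) q M)⁻¹ʳ * qBinomSeries (z * q) (w * q) q M := by
  have hunit (c : B) : IsUnit (qPoch (c * q) q M) :=
    isUnit_qPoch_of_isNilpotent (isNilpotent_mul_of_pow_eq_zero hq c) q M
  have hqq : (1 - q) * qPoch (z * q * (w * q)) q M = qPoch q q M := by
    rw [show z * q * (w * q) = q * q by linear_combination q * q * hzw, ← qPoch_succ',
      qPoch_add_of_mul_pow_eq_zero (by rw [← pow_succ', hq])]
  refine ((hunit z).mul (hunit w)).mul_right_cancel ?_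
  rw [crankSeries_mul_qPoch_mul_qPoch (isUnit_one_sub_mul_one_sub hq z w), ← hqq,
    ← qBinomSeries_mul_qPoch hq (z * q) w]
  linear_combination (-(1 - q) * qBinomSeries (z * q) (w * q) q M * qPoch (w * q) q M) *
    Ring.inverse_mul_cancel _ (hunit z)

lemma map_qBinomSeries (φ : B →+* B') {q : B} (hunit : ∀ j, IsUnit (qPoch q q j)) (c t : B)
    (M : ℕ) : φ (qBinomSeries c t q M) = qBinomSeries (φ c) (φ t) (φ q) M := by
  simp only [qBinomSeries, map_sum, map_mul, map_pow, map_qPoch, map_ringInverse φ (hunit _)]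

lemma map_rankSeries (φ : B →+* B') {w q : B} (hunit : ∀ j, IsUnit (qPoch (w * q) q j)) (z : B)
    (M : ℕ) : φ (rankSeries z w q M) = rankSeries (φ z) (φ w) (φ q) M := by
  simp only [rankSeries, map_add, map_one, map_sum, map_mul, map_pow, map_qPoch,
    map_ringInverse φ (hunit _)]

lemma map_sptSeries (φ : B →+* B') {z w q : B}
    (hunit : ∀ i, IsUnit ((1 - z * q ^ (i + 1)) * (1 - w * q ^ (i + 1)))) (M : ℕ) :
    φ (sptSeries z w q M) = sptSeries (φ z) (φ w) (φ q) M := by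
  simp only [sptSeries, crankFactor, map_sum, map_prod, map_mul, map_sub, map_one, map_pow,
    map_ringInverse φ (hunit _)]

end QSeries

section PowerSeries

variable {A : Type*} [CommRing A]

lemma isUnit_one_sub_of_constantCoeff_eq_zero {f : A⟦X⟧} (hf : constantCoeff f = 0) :
    IsUnit (1 - f) := by
  simp [isUnit_iff_constantCoeff, hf]

lemma isUnit_qPoch_of_constantCoeff_eq_zero {f : A⟦X⟧} (hf : constantCoeff f = 0) (q : A⟦X⟧)
    (n : ℕ) : IsUnit (qPoch f q n) := by
  simp [isUnit_iff_constantCoeff, map_qPoch, hf]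

lemma coeff_eq_coeff_of_mk_eq_mk {n : ℕ} {f g : A⟦X⟧}
    (h : Ideal.Quotient.mk (Ideal.span {(X : A⟦X⟧) ^ (n + 1)}) f =
      Ideal.Quotient.mk (Ideal.span {(X : A⟦X⟧) ^ (n + 1)}) g) :
    coeff n f = coeff n g := by
  rw [Ideal.Quotient.eq, Ideal.mem_span_singleton, X_pow_dvd_iff] at h
  simpa [sub_eq_zero] using h n n.lt_succ_self

lemma mk_X_pow_eq_zero (n : ℕ) :
    Ideal.Quotient.mk (Ideal.span {(X : A⟦X⟧) ^ (n + 1)}) X ^ (n + 1) = 0 := by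
  rw [← map_pow]
  exact Ideal.Quotient.eq_zero_iff_mem.2 (Ideal.mem_span_singleton_self _)

theorem coeff_mul_qBinomSeries_zero_left (f : A⟦X⟧) (w : A) (n : ℕ) :
    coeff n (f * qBinomSeries 0 (C w * X) X n) =
      coeff n (f * (qPoch (C w * X) X n)⁻¹ʳ) := by
  refine coeff_eq_coeff_of_mk_eq_mk ?_
  rw [map_mul, map_mul, map_qBinomSeries _ (isUnit_qPoch_of_constantCoeff_eq_zero (by simp) X),
    map_ringInverse _ (isUnit_qPoch_of_constantCoeff_eq_zero (by simp) X n), map_qPoch, map_mul,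
    map_zero, qBinomSeries_zero_left (mk_X_pow_eq_zero n)]

theorem coeff_crank_sub_coeff_rankSeries {z w : A} (hzw : z * w = 1) (n : ℕ) :
    coeff n ((1 - X) * (qPoch (C z * X) X n)⁻¹ʳ * qBinomSeries (C z * X) (C w * X) X n) -
      coeff n (rankSeries (C z) (C w) X n) =
        (z + w - 2) * coeff n (sptSeries (C z) (C w) X n) := by
  have hunit (c : A) (j : ℕ) : IsUnit (qPoch (C c * X) X j) :=
    isUnit_qPoch_of_constantCoeff_eq_zero (by simp) X j
  have hfactor (i : ℕ) :
      IsUnit ((1 - C z * (X : A⟦X⟧) ^ (i + 1)) * (1 - C w * (X : A⟦X⟧) ^ (i + 1))) :=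
    (isUnit_one_sub_of_constantCoeff_eq_zero (by simp)).mul
      (isUnit_one_sub_of_constantCoeff_eq_zero (by simp))
  rw [← coeff_C_mul, ← map_sub]
  refine coeff_eq_coeff_of_mk_eq_mk ?_
  set π := Ideal.Quotient.mk (Ideal.span {(X : A⟦X⟧) ^ (n + 1)})
  have hX : π X ^ (n + 1) = 0 := mk_X_pow_eq_zero n
  have hπ : π (C z) * π (C w) = 1 := by rw [← map_mul, ← map_mul, hzw, map_one, map_one]
  rw [map_sub, map_mul, map_mul, map_mul,
    map_qBinomSeries π (isUnit_qPoch_of_constantCoeff_eq_zero (by simp) X),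
    map_rankSeries π (hunit w), map_sptSeries π hfactor, map_ringInverse π (hunit z n), map_qPoch,
    map_sub, map_one, map_mul, map_mul, ← crankSeries_eq_mul_qBinomSeries hX hπ,
    rankSeries_eq_crankSeries_sub hX hπ, map_sub, map_add, map_ofNat, map_sub, map_add, map_ofNat]
  ring

end PowerSeries

section PartitionSeries

variable {A : Type*} [CommSemiring A]

/-- The generating function of partitions `p` of `n`, counted with the weight `F p.parts`. -/
def partitionSeries (F : Multiset ℕ → A) : A⟦X⟧ :=
  PowerSeries.mk fun n => ∑ p : n.Partition, F p.parts

lemma coeff_partitionSeries (F : Multiset ℕ → A) (n : ℕ) :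
    coeff n (partitionSeries F) = ∑ p : n.Partition, F p.parts := coeff_mk _ _

lemma partitionSeries_add (F G : Multiset ℕ → A) :
    partitionSeries (fun m => F m + G m) = partitionSeries F + partitionSeries G := by
  ext n
  simp [coeff_partitionSeries, sum_add_distrib]

lemma partitionSeries_const_mul (c : A) (F : Multiset ℕ → A) :
    partitionSeries (fun m => c * F m) = C c * partitionSeries F := by
  ext n
  simp [coeff_partitionSeries, mul_sum]

lemma partitionSeries_ite_mem {a : ℕ} (ha : a ≠ 0) (F : Multiset ℕ → A) :
    partitionSeries (fun m => if a ∈ m then F m else 0) =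
      X ^ a * partitionSeries (fun m => F (a ::ₘ m)) := by
  ext n
  rw [coeff_X_pow_mul', coeff_partitionSeries, ← sum_filter]
  split_ifs with han
  · rw [coeff_partitionSeries, sum_subtype (p := fun p : n.Partition => a ∈ p.parts) _ (by simp)]
    refine Fintype.sum_equiv (Nat.Partition.partitionWithPartEquiv (Nat.pos_of_ne_zero ha) han)
      _ _ fun p => ?_
    rw [Nat.Partition.partitionWithPartEquiv_apply_parts, Multiset.cons_erase p.2]
  · exact sum_eq_zero fun p hp => absurd (p.le_of_mem_parts (mem_filter.1 hp).2) han

/-- The weight `∏ w i` over the parts `i` of a partition, for partitions with all parts in `s`;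
the other partitions have weight `0`. -/
def partsWeight (s : Finset ℕ) (w : ℕ → A) (m : Multiset ℕ) : A :=
  if ∀ i ∈ m, i ∈ s then (m.map w).prod else 0

lemma partsWeight_cons {s : Finset ℕ} {a : ℕ} (ha : a ∈ s) (w : ℕ → A) (m : Multiset ℕ) :
    partsWeight s w (a ::ₘ m) = w a * partsWeight s w m := by
  simp [partsWeight, ha]

lemma partsWeight_insert {s : Finset ℕ} {a : ℕ} (ha : a ∉ s) (w : ℕ → A) (m : Multiset ℕ) :
    partsWeight (insert a s) w m =
      partsWeight s w m + if a ∈ m then partsWeight (insert a s) w m else 0 := by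
  by_cases ham : a ∈ m
  · have hs : ¬ ∀ i ∈ m, i ∈ s := fun h => ha (h a ham)
    simp [partsWeight, ham, hs]
  · have hiff : (∀ i ∈ m, i ∈ insert a s) ↔ ∀ i ∈ m, i ∈ s :=
      forall₂_congr fun i hi => mem_insert.trans (or_iff_right fun h => ham (h ▸ hi))
    simp only [partsWeight, hiff, ham, if_false, add_zero]

lemma partitionSeries_ite_mem_partsWeight {s : Finset ℕ} {a : ℕ} (ha : a ≠ 0) (has : a ∈ s)
    (w : ℕ → A) :
    partitionSeries (fun m => if a ∈ m then partsWeight s w m else 0) =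
      C (w a) * X ^ a * partitionSeries (partsWeight s w) := by
  simp only [partitionSeries_ite_mem ha, partsWeight_cons has, partitionSeries_const_mul]
  ring

lemma partitionSeries_partsWeight_empty (w : ℕ → A) :
    partitionSeries (partsWeight ∅ w) = 1 := by
  ext n
  rw [coeff_partitionSeries, coeff_one]
  split_ifs with hn
  · subst hn
    simp [partsWeight]
  · refine sum_eq_zero fun p _ => if_neg fun h => hn ?_
    have hp : p.parts = 0 := Multiset.eq_zero_of_forall_notMem fun i hi => by simpa using h i hi
    simpa [hp] using p.parts_sum.symm

theorem partitionSeries_count_eq {s : Finset ℕ} {a : ℕ} (ha : a ≠ 0) (has : a ∉ s) (w : ℕ → A)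
    (j : ℕ) :
    partitionSeries (fun m => if m.count a = j then partsWeight (insert a s) w m else 0) =
      (C (w a) * X ^ a) ^ j * partitionSeries (partsWeight s w) := by
  induction j with
  | zero =>
    rw [pow_zero, one_mul]
    congr 1
    ext m
    by_cases ham : a ∈ m
    · have hs : ¬ ∀ i ∈ m, i ∈ s := fun h => has (h a ham)
      rw [if_neg (by simpa using ham), partsWeight, if_neg hs]
    · rw [if_pos (Multiset.count_eq_zero.2 ham), partsWeight_insert has, if_neg ham, add_zero]
  | succ j ih =>
    have hsplit (m : Multiset ℕ) :
        (if m.count a = j + 1 then partsWeight (insert a s) w m else 0) =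
          if a ∈ m then if m.count a = j + 1 then partsWeight (insert a s) w m else 0 else 0 := by
      by_cases ham : a ∈ m
      · rw [if_pos ham]
      · rw [if_neg ham, Multiset.count_eq_zero.2 ham, if_neg j.succ_ne_zero.symm]
    simp only [funext hsplit, partitionSeries_ite_mem ha, Multiset.count_cons_self,
      add_left_inj, partsWeight_cons (mem_insert_self a s), ← mul_ite_zero,
      partitionSeries_const_mul, ih]
    ring

end PartitionSeries

section Partitions

variable {A : Type*} [CommRing A]

theorem partitionSeries_partsWeight {s : Finset ℕ} (hs : 0 ∉ s) (w : ℕ → A) :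
    partitionSeries (partsWeight s w) = (∏ i ∈ s, (1 - C (w i) * X ^ i))⁻¹ʳ := by
  have hunit : IsUnit (∏ i ∈ s, (1 - C (w i) * (X : A⟦X⟧) ^ i)) :=
    prod_induction _ IsUnit (fun _ _ => IsUnit.mul) isUnit_one fun i hi =>
      isUnit_one_sub_of_constantCoeff_eq_zero (by simp [ne_of_mem_of_not_mem hi hs])
  rw [← one_mul (_⁻¹ʳ), Ring.eq_mul_inverse_iff_mul_eq _ _ _ hunit]
  clear hunit
  induction s using Finset.induction_on with
  | empty => simp [partitionSeries_partsWeight_empty]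
  | insert a s ha ih =>
    have ha0 : a ≠ 0 := fun h => hs (h ▸ mem_insert_self a s)
    have hrec : partitionSeries (partsWeight (insert a s) w) =
        partitionSeries (partsWeight s w) +
          C (w a) * X ^ a * partitionSeries (partsWeight (insert a s) w) := by
      rw [← partitionSeries_ite_mem_partsWeight ha0 (mem_insert_self a s), ← partitionSeries_add,
        ← funext (partsWeight_insert ha w)]
    rw [prod_insert ha]
    linear_combination ih (fun h => hs (mem_insert_of_mem h)) +
      (∏ i ∈ s, (1 - C (w i) * X ^ i)) * hrec

lemma prod_Ico_one_sub_eq_qPoch (c : A) (b n : ℕ) :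
    ∏ i ∈ Ico b n, (1 - C c * X ^ i) = qPoch (C c * X ^ b) X (n - b) := by
  simp only [prod_Ico_eq_prod_range, qPoch, pow_add, mul_assoc]

theorem partitionSeries_sup_eq {b N : ℕ} (hb : b ≠ 0) (hbN : b ≤ N) (w : ℕ → A) :
    partitionSeries (fun m => if m.sup = N ∧ ∀ i ∈ m, b ≤ i then (m.map w).prod else 0) =
      C (w N) * X ^ N * (∏ i ∈ Ico b (N + 1), (1 - C (w i) * X ^ i))⁻¹ʳ := by
  have hN : N ≠ 0 := by omega
  rw [← partitionSeries_partsWeight (by simp [hb]),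
    ← partitionSeries_ite_mem_partsWeight hN (by simp [hbN])]
  congr 1
  ext m
  have hiff : (m.sup = N ∧ ∀ i ∈ m, b ≤ i) ↔ N ∈ m ∧ ∀ i ∈ m, i ∈ Ico b (N + 1) := by
    simp only [sup_eq_iff_mem_and_forall_le hN, mem_Ico, Nat.lt_succ_iff, forall_and]
    tauto
  simp only [partsWeight, ← ite_and, hiff]

lemma sup_parts_pos {n : ℕ} (hn : n ≠ 0) (p : n.Partition) : 0 < p.parts.sup := by
  have hp : p.parts ≠ 0 := fun h => hn (by simpa [h] using p.parts_sum.symm)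
  obtain ⟨i, hi⟩ := Multiset.exists_mem_of_ne_zero hp
  exact (p.parts_pos hi).trans_le (Multiset.le_sup hi)

lemma sup_parts_le {n : ℕ} (p : n.Partition) : p.parts.sup ≤ n :=
  Multiset.sup_le.2 fun _ hi => p.le_of_mem_parts hi

lemma card_parts_le {n : ℕ} (p : n.Partition) : Multiset.card p.parts ≤ n := by
  simpa [p.parts_sum] using
    Multiset.card_nsmul_le_sum (s := p.parts) (a := 1) (fun _ hi => p.parts_pos hi)

lemma sum_zpow_rank_of_sup_eq (z : Aˣ) (n j : ℕ) :
    ∑ p : n.Partition with p.parts.sup = j + 1, ((z ^ rank p : Aˣ) : A) =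
      coeff n (C (z : A) ^ j * X ^ (j + 1) * (qPoch (C (↑z⁻¹ : A) * X) X (j + 1))⁻¹ʳ) := by
  have hseries := congrArg (coeff n)
    (partitionSeries_sup_eq one_ne_zero (Nat.le_add_left 1 j) fun _ => (↑z⁻¹ : A))
  rw [prod_Ico_one_sub_eq_qPoch, coeff_partitionSeries, pow_one, Nat.add_sub_cancel] at hseries
  calc
    _ = (z : A) ^ (j + 1) * coeff n (C (↑z⁻¹ : A) * X ^ (j + 1) *
          (qPoch (C (↑z⁻¹ : A) * X) X (j + 1))⁻¹ʳ) := by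
      rw [← hseries, sum_filter, mul_sum]
      refine sum_congr rfl fun p _ => ?_
      have hpos : ∀ i ∈ p.parts, 1 ≤ i := fun i hi => p.parts_pos hi
      by_cases hp : p.parts.sup = j + 1
      · rw [if_pos hp, if_pos ⟨hp, hpos⟩, Multiset.map_const', Multiset.prod_replicate, rank, hp,
          zpow_sub, zpow_natCast, zpow_natCast, ← inv_pow, Units.val_mul, Units.val_pow_eq_pow_val,
          Units.val_pow_eq_pow_val]
      · rw [if_neg hp, if_neg fun h => hp h.1, mul_zero]
    _ = _ := by
      rw [← coeff_C_mul, map_pow]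
      have hz : C (z : A) * C (↑z⁻¹ : A) = 1 := by rw [← map_mul, Units.mul_inv, map_one]
      congr 1
      linear_combination (C (z : A) ^ j * X ^ (j + 1) *
        (qPoch (C (↑z⁻¹ : A) * X) X (j + 1))⁻¹ʳ) * hz

theorem sum_zpow_rank (z : Aˣ) {n : ℕ} (hn : n ≠ 0) :
    ∑ p : n.Partition, ((z ^ rank p : Aˣ) : A) =
      coeff n (rankSeries (C (z : A)) (C (↑z⁻¹ : A)) X n) := by
  rw [← sum_fiberwise_of_maps_to (t := range (n + 1)) (g := fun p : n.Partition => p.parts.sup)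
      fun p _ => mem_range_succ_iff.2 (sup_parts_le p), sum_range_succ',
    sum_congr rfl fun j _ => sum_zpow_rank_of_sup_eq z n j,
    filter_false_of_mem fun p _ => (sup_parts_pos hn p).ne', sum_empty, add_zero, rankSeries,
    map_add, coeff_one, if_neg hn, zero_add, map_sum]

lemma count_one_eq_zero_iff {n : ℕ} (p : n.Partition) :
    p.parts.count 1 = 0 ↔ ∀ i ∈ p.parts, 2 ≤ i := by
  rw [Multiset.count_eq_zero]
  refine ⟨fun h i hi => (Nat.succ_le_of_lt (p.parts_pos hi)).lt_of_ne ?_, fun h h1 => ?_⟩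
  · rintro rfl
    exact h hi
  · exact absurd (h 1 h1) (by norm_num)

variable (A) in
lemma card_count_one_eq_zero_and_sup_eq {n : ℕ} (hn : 2 ≤ n) (N : ℕ) :
    (#{p : n.Partition | p.parts.count 1 = 0 ∧ p.parts.sup = N} : A) =
      coeff n (X ^ N * ((1 - X) * (qPoch X X N)⁻¹ʳ)) := by
  have hunit : IsUnit (1 - X : A⟦X⟧) := isUnit_one_sub_of_constantCoeff_eq_zero (by simp)
  rcases lt_or_ge N 2 with hN | hN
  · rw [filter_false_of_mem, card_empty, Nat.cast_zero]
    · interval_cases N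
      · simp [coeff_X, coeff_one, show n ≠ 0 by omega, show n ≠ 1 by omega]
      · rw [one_sub_mul_inverse_qPoch_succ hunit, qPoch_zero, Ring.inverse_one, mul_one, pow_one,
          coeff_X, if_neg (by omega)]
    · rintro p - ⟨hp, rfl⟩
      have hsup := sup_parts_pos (by omega) p
      exact hN.not_ge ((count_one_eq_zero_iff p).1 hp _ (sup_mem_of_sup_ne_bot hsup.ne'))
  · have hseries := congrArg (coeff n) (partitionSeries_sup_eq two_ne_zero hN fun _ => (1 : A))
    obtain ⟨k, rfl⟩ := Nat.exists_eq_add_of_le' (show 1 ≤ N by omega)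
    rw [prod_Ico_one_sub_eq_qPoch, coeff_partitionSeries] at hseries
    simp only [Multiset.map_const', Multiset.prod_replicate, one_pow, map_one, one_mul,
      ← count_one_eq_zero_iff, sum_boole] at hseries
    simp only [and_comm, hseries, one_sub_mul_inverse_qPoch_succ hunit, Nat.reduceSubDiff]

theorem sum_pow_sup_of_count_one_eq_zero (z : A) {n : ℕ} (hn : 2 ≤ n) :
    ∑ p : n.Partition with p.parts.count 1 = 0, z ^ p.parts.sup =
      coeff n ((1 - X) * (qPoch (C z * X) X n)⁻¹ʳ) := by
  -- Euler's expansion of `1 / (z q)_n` in powers of `z` takes the place of conjugating partitions.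
  rw [← coeff_mul_qBinomSeries_zero_left, qBinomSeries, mul_sum, map_sum,
    ← sum_fiberwise_of_maps_to (t := range (n + 1)) (g := fun p : n.Partition => p.parts.sup)
      fun p _ => mem_range_succ_iff.2 (sup_parts_le p)]
  refine sum_congr rfl fun N _ => ?_
  rw [filter_filter, sum_congr rfl (g := fun _ => z ^ N) fun p hp => by rw [(mem_filter.1 hp).2.2],
    sum_const, nsmul_eq_mul, card_count_one_eq_zero_and_sup_eq A hn, qPoch_zero_left, one_mul,
    mul_pow, ← map_pow, mul_comm, ← coeff_C_mul]
  congr 1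
  ring

lemma prod_Ico_two_eq_qPoch_mul_qPoch (c : A) {j n : ℕ} (hj : j ≠ 0) (hjn : j ≤ n) :
    ∏ i ∈ Ico 2 (n + 1), (1 - C (if j < i then c else 1) * X ^ i) =
      qPoch (X ^ 2) X (j - 1) * qPoch (C c * X ^ (j + 1)) X (n - j) := by
  rw [← prod_Ico_consecutive _ (show 2 ≤ j + 1 by omega) (show j + 1 ≤ n + 1 by omega),
    prod_congr rfl (g := fun i => 1 - C 1 * X ^ i) fun i hi => by
      rw [if_neg (by have := mem_Ico.1 hi; omega)],
    prod_congr (s₁ := Ico (j + 1) (n + 1)) rfl (g := fun i => 1 - C c * X ^ i) fun i hi => by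
      rw [if_pos (by have := mem_Ico.1 hi; omega)],
    prod_Ico_one_sub_eq_qPoch, prod_Ico_one_sub_eq_qPoch, map_one, one_mul]
  congr 1
  all_goals congr 1; omega

lemma sum_pow_countP_of_count_one_eq (z w : A) {j n : ℕ} (hj : j ≠ 0) (hjn : j ≤ n) :
    ∑ p : n.Partition with p.parts.count 1 = j, w ^ j * z ^ p.parts.countP (j < ·) =
      coeff n ((C w * X) ^ j *
        (qPoch (X ^ 2) X (j - 1) * qPoch (C z * X ^ (j + 1)) X (n - j))⁻¹ʳ) := by
  let weight (i : ℕ) : A := (if 1 = i then w else 1) * if j < i then z else 1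
  have hone : 1 ∉ Ico 2 (n + 1) := by simp
  have hseries := congrArg (coeff n) (partitionSeries_count_eq one_ne_zero hone weight j)
  have hweight : ∀ i ∈ Ico 2 (n + 1), weight i = if j < i then z else 1 := fun i hi => by
    rw [mem_Ico] at hi
    simp only [weight, if_neg (show 1 ≠ i by omega), one_mul]
  have hweight_one : weight 1 = w := by simp [weight, show ¬ j < 1 by omega]
  rw [partitionSeries_partsWeight (by simp), prod_congr rfl fun i hi => by rw [hweight i hi],
    prod_Ico_two_eq_qPoch_mul_qPoch z hj hjn, hweight_one, pow_one, coeff_partitionSeries]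
    at hseries
  rw [← hseries, sum_filter]
  refine sum_congr rfl fun p _ => ?_
  have hparts : ∀ i ∈ p.parts, i ∈ insert 1 (Ico 2 (n + 1)) := fun i hi => by
    have hpos := p.parts_pos hi
    have hle := p.le_of_mem_parts hi
    simp only [mem_insert, mem_Ico]
    omega
  refine if_ctx_congr Iff.rfl (fun hp => ?_) fun _ => rfl
  rw [partsWeight, if_pos hparts, Multiset.prod_map_mul, prod_map_ite_eq_pow_countP,
    prod_map_ite_eq_pow_countP, ← hp]
  rfl

lemma sum_zpow_crank_of_count_one_eq (z : Aˣ) {j n : ℕ} (hn : 2 ≤ n) (hjn : j ≤ n) :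
    ∑ p : n.Partition with p.parts.count 1 = j, ((z ^ crank p : Aˣ) : A) =
      coeff n ((1 - X) * (qPoch (C (z : A) * X) X n)⁻¹ʳ * (qPoch (C (z : A) * X) X j *
        (C (↑z⁻¹ : A) * X) ^ j * (qPoch X X j)⁻¹ʳ)) := by
  rcases j.eq_zero_or_pos with rfl | hj
  · rw [qPoch_zero, qPoch_zero, pow_zero, Ring.inverse_one, mul_one, mul_one, mul_one,
      ← sum_pow_sup_of_count_one_eq_zero (z : A) hn]
    refine sum_congr rfl fun p hp => ?_
    rw [crank, if_pos (mem_filter.1 hp).2, zpow_natCast, Units.val_pow_eq_pow_val]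
  · have hX : IsUnit (1 - X : A⟦X⟧) := isUnit_one_sub_of_constantCoeff_eq_zero (by simp)
    have hz : IsUnit (qPoch (C (z : A) * X) X j) :=
      isUnit_qPoch_of_constantCoeff_eq_zero (by simp) X j
    have hzn := inverse_qPoch_mul_qPoch hz hjn
    have hXj := one_sub_mul_inverse_qPoch_succ hX (j - 1)
    rw [mul_assoc, ← pow_succ'] at hzn
    rw [Nat.sub_add_cancel hj] at hXj
    have hunit : IsUnit (qPoch (X ^ 2 : A⟦X⟧) X (j - 1)) :=
      isUnit_qPoch_of_constantCoeff_eq_zero (by simp) X _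
    calc
      _ = ∑ p : n.Partition with p.parts.count 1 = j,
            (↑z⁻¹ : A) ^ j * (z : A) ^ p.parts.countP (j < ·) := by
        refine sum_congr rfl fun p hp => ?_
        rw [crank, (mem_filter.1 hp).2, if_neg hj.ne', zpow_sub, zpow_natCast, zpow_natCast,
          ← inv_pow, mul_comm, Units.val_mul, Units.val_pow_eq_pow_val, Units.val_pow_eq_pow_val]
      _ = _ := by
        rw [sum_pow_countP_of_count_one_eq _ _ hj.ne' hjn, Ring.inverse_mul (Or.inl hunit), ← hXj,
          ← hzn]
        congr 1
        ring

theorem sum_zpow_crank (z : Aˣ) {n : ℕ} (hn : 2 ≤ n) :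
    ∑ p : n.Partition, ((z ^ crank p : Aˣ) : A) =
      coeff n ((1 - X) * (qPoch (C (z : A) * X) X n)⁻¹ʳ *
        qBinomSeries (C (z : A) * X) (C (↑z⁻¹ : A) * X) X n) := by
  rw [qBinomSeries, mul_sum, map_sum, ← sum_fiberwise_of_maps_to (t := range (n + 1))
    (g := fun p : n.Partition => p.parts.count 1) fun p _ =>
      mem_range_succ_iff.2 ((Multiset.count_le_card 1 p.parts).trans (card_parts_le p))]
  exact sum_congr rfl fun j hj =>
    sum_zpow_crank_of_count_one_eq z hn (mem_range_succ_iff.1 hj)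

theorem sum_zpow_crank_sub_sum_zpow_rank (z : Aˣ) {n : ℕ} (hn : 2 ≤ n) :
    ∑ p : n.Partition, ((z ^ crank p : Aˣ) : A) - ∑ p : n.Partition, ((z ^ rank p : Aˣ) : A) =
      ((z : A) + (↑z⁻¹ : A) - 2) *
        coeff n (sptSeries (C (z : A)) (C (↑z⁻¹ : A)) X n) := by
  rw [sum_zpow_crank z hn, sum_zpow_rank z (by omega), coeff_crank_sub_coeff_rankSeries z.mul_inv]

end Partitions

section CoeffsIn

variable {A : Type*} [Semiring A] {S : Subsemiring A}

/-- The power series all of whose coefficients lie in `S`. It serves as a cone of positive series,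
and is applied with `S` itself a cone of power series in a second variable. -/
def coeffsIn (S : Subsemiring A) : Subsemiring A⟦X⟧ where
  carrier := {f | ∀ n, coeff n f ∈ S}
  mul_mem' hf hg n := by
    rw [coeff_mul]
    exact sum_mem fun i _ => mul_mem (hf i.1) (hg i.2)
  one_mem' n := by
    rw [coeff_one]
    split_ifs
    exacts [one_mem S, zero_mem S]
  add_mem' hf hg n := by
    rw [map_add]
    exact add_mem (hf n) (hg n)
  zero_mem' n := by
    rw [map_zero]
    exact zero_mem S

lemma C_mem_coeffsIn {a : A} (ha : a ∈ S) : C a ∈ coeffsIn S := fun n => by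
  rw [coeff_C]
  split_ifs
  exacts [ha, zero_mem S]

lemma X_mem_coeffsIn : (X : A⟦X⟧) ∈ coeffsIn S := fun n => by
  rw [coeff_X]
  split_ifs
  exacts [one_mem S, zero_mem S]

end CoeffsIn

section Positivity

variable {A : Type*} [CommRing A] {S : Subsemiring A}

lemma inverse_one_sub_mem_coeffsIn {f : A⟦X⟧} (hf : f ∈ coeffsIn S) (hf0 : constantCoeff f = 0) :
    (1 - f)⁻¹ʳ ∈ coeffsIn S := by
  have hrec : (1 - f)⁻¹ʳ = 1 + f * (1 - f)⁻¹ʳ := by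
    linear_combination Ring.mul_inverse_cancel _ (isUnit_one_sub_of_constantCoeff_eq_zero hf0)
  intro n
  induction n using Nat.strong_induction_on with
  | _ n ih =>
    rw [hrec, map_add, coeff_mul]
    refine add_mem (one_mem (coeffsIn S) n) (sum_mem fun ⟨i, j⟩ hij => ?_)
    rcases i.eq_zero_or_pos with rfl | hi
    · rw [coeff_zero_eq_constantCoeff_apply, hf0, zero_mul]
      exact zero_mem S
    · exact mul_mem (hf i) (ih j (by have := mem_antidiagonal.1 hij; omega))

lemma mul_inverse_one_sub_mem_coeffsIn (i : ℕ) :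
    (X : A⟦X⟧) ^ (i + 1) * (1 - X ^ (i + 1))⁻¹ʳ ∈ coeffsIn S :=
  have hX : (X : A⟦X⟧) ^ (i + 1) ∈ coeffsIn S := pow_mem X_mem_coeffsIn _
  mul_mem hX (inverse_one_sub_mem_coeffsIn hX (by simp))

lemma crankFactor_eq_inverse_one_sub {z w : A} (hzw : z * w = 1) (i : ℕ) :
    crankFactor (C z) (C w) X i =
      (1 - (X ^ (i + 1) + C (z + w - 2) * (X ^ (i + 1) * (1 - X ^ (i + 1))⁻¹ʳ)))⁻¹ʳ := by
  have hunit : IsUnit (1 - (X : A⟦X⟧) ^ (i + 1)) :=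
    isUnit_one_sub_of_constantCoeff_eq_zero (by simp)
  have hC : C z * C w = 1 := by rw [← map_mul, hzw, map_one]
  have hfactor : (1 - C z * (X : A⟦X⟧) ^ (i + 1)) * (1 - C w * X ^ (i + 1)) =
      (1 - (X ^ (i + 1) + C (z + w - 2) * (X ^ (i + 1) * (1 - X ^ (i + 1))⁻¹ʳ))) *
        (1 - X ^ (i + 1)) := by
    rw [map_sub, map_add, map_ofNat]
    linear_combination (X : A⟦X⟧) ^ (i + 1) * X ^ (i + 1) * hC +
      (C z + C w - 2) * X ^ (i + 1) * Ring.mul_inverse_cancel _ hunit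
  rw [crankFactor, hfactor, Ring.inverse_mul (Or.inr hunit), ← mul_assoc,
    Ring.mul_inverse_cancel _ hunit, one_mul]

lemma crankFactor_sub_one_mem_coeffsIn {z w : A} (hzw : z * w = 1) (hS : z + w - 2 ∈ S) (i : ℕ) :
    crankFactor (C z) (C w) X i - 1 ∈ coeffsIn S := by
  set f : A⟦X⟧ := X ^ (i + 1) + C (z + w - 2) * (X ^ (i + 1) * (1 - X ^ (i + 1))⁻¹ʳ) with hf
  have hfS : f ∈ coeffsIn S :=
    add_mem (pow_mem X_mem_coeffsIn _)
      (mul_mem (C_mem_coeffsIn hS) (mul_inverse_one_sub_mem_coeffsIn i))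
  have hf0 : constantCoeff f = 0 := by simp [hf]
  have hrec : (1 - f)⁻¹ʳ - 1 = f * (1 - f)⁻¹ʳ := by
    linear_combination Ring.mul_inverse_cancel _ (isUnit_one_sub_of_constantCoeff_eq_zero hf0)
  rw [crankFactor_eq_inverse_one_sub hzw, hrec]
  exact mul_mem hfS (inverse_one_sub_mem_coeffsIn hfS hf0)

lemma sptSeries_eq_sum_prod_crankFactor (z w : A) (M : ℕ) :
    sptSeries (C z) (C w) X M =
      ∑ i ∈ range M, X ^ (i + 1) * (1 - X ^ (i + 1))⁻¹ʳ *
        ∏ l ∈ Ico i M, crankFactor (C z) (C w) X l := by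
  refine sum_congr rfl fun i hi => ?_
  have hunit : IsUnit (1 - (X : A⟦X⟧) ^ (i + 1)) :=
    isUnit_one_sub_of_constantCoeff_eq_zero (by simp)
  rw [prod_eq_prod_Ico_succ_bot (mem_range.1 hi), crankFactor]
  simp only [mul_assoc, Ring.inverse_mul_cancel_left _ _ hunit]

lemma sptSeries_sub_mem_coeffsIn {z w : A} (hzw : z * w = 1) (hS : z + w - 2 ∈ S) {M : ℕ}
    (hM : M ≠ 0) : sptSeries (C z) (C w) X M - X * (1 - X)⁻¹ʳ ∈ coeffsIn S := by
  have hprod (i : ℕ) : ∏ l ∈ Ico i M, crankFactor (C z) (C w) X l - 1 ∈ coeffsIn S :=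
    prod_sub_one_mem fun l _ => crankFactor_sub_one_mem_coeffsIn hzw hS l
  have hterm (i : ℕ) : X ^ (i + 1) * (1 - X ^ (i + 1))⁻¹ʳ *
      ∏ l ∈ Ico i M, crankFactor (C z) (C w) X l ∈ coeffsIn S := by
    refine mul_mem (mul_inverse_one_sub_mem_coeffsIn i) ?_
    rw [← sub_add_cancel (∏ l ∈ Ico i M, crankFactor (C z) (C w) X l) 1]
    exact add_mem (hprod i) (one_mem _)
  obtain ⟨N, rfl⟩ := Nat.exists_eq_succ_of_ne_zero hM
  rw [sptSeries_eq_sum_prod_crankFactor, sum_range_succ', add_sub_assoc]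
  refine add_mem (sum_mem fun i _ => hterm (i + 1)) ?_
  rw [zero_add, pow_one, ← mul_sub_one]
  have hX := mul_inverse_one_sub_mem_coeffsIn (S := S) 0
  rw [zero_add, pow_one] at hX
  exact mul_mem hX (hprod 0)

variable (A) in
lemma coeff_X_mul_inverse_one_sub {n : ℕ} (hn : n ≠ 0) :
    coeff n (X * (1 - X : A⟦X⟧)⁻¹ʳ) = 1 := by
  have hinv : (1 - X : A⟦X⟧)⁻¹ʳ = PowerSeries.mk 1 := by
    rw [← one_mul (_⁻¹ʳ), eq_comm, Ring.eq_mul_inverse_iff_mul_eq _ _ _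
      (isUnit_one_sub_of_constantCoeff_eq_zero (by simp)), mk_one_mul_one_sub_eq_one]
  obtain ⟨m, rfl⟩ := Nat.exists_eq_succ_of_ne_zero hn
  rw [Nat.succ_eq_add_one, coeff_succ_X_mul, hinv, coeff_mk, Pi.one_apply]

theorem sum_zpow_crank_sub_sum_zpow_rank_sub_mem {z : Aˣ}
    (hS : (z : A) + (↑z⁻¹ : A) - 2 ∈ S) {n : ℕ} (hn : 2 ≤ n) :
    ∑ p : n.Partition, ((z ^ crank p : Aˣ) : A) - ∑ p : n.Partition, ((z ^ rank p : Aˣ) : A) -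
      ((z : A) + (↑z⁻¹ : A) - 2) ∈ S := by
  have hspt := sptSeries_sub_mem_coeffsIn z.mul_inv hS (show n ≠ 0 by omega) n
  rw [map_sub, coeff_X_mul_inverse_one_sub A (by omega)] at hspt
  rw [sum_zpow_crank_sub_sum_zpow_rank z hn, ← mul_sub_one]
  exact mul_mem hS hspt

end Positivity

section Moments

/-- The unit `e ^ t` of `ℚ⟦t⟧`. -/
noncomputable def expUnit : ℚ⟦X⟧ˣ where
  val := exp ℚ
  inv := evalNegHom (exp ℚ)
  val_inv := exp_mul_exp_neg_eq_one
  inv_val := by rw [mul_comm, exp_mul_exp_neg_eq_one]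

lemma coeff_expUnit_zpow (m : ℤ) (j : ℕ) :
    coeff j ((expUnit ^ m : ℚ⟦X⟧ˣ) : ℚ⟦X⟧) = (m : ℚ) ^ j / j.factorial := by
  have hrescale : ((expUnit ^ m : ℚ⟦X⟧ˣ) : ℚ⟦X⟧) = rescale (m : ℚ) (exp ℚ) := by
    cases m using Int.negInduction with
    | nat k => rw [zpow_natCast, Units.val_pow_eq_pow_val]; exact exp_pow_eq_rescale_exp k
    | neg h k =>
      rw [zpow_neg, zpow_natCast, ← inv_pow, Units.val_pow_eq_pow_val]
      change evalNegHom (exp ℚ) ^ k = _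
      rw [← map_pow, exp_pow_eq_rescale_exp, evalNegHom, rescale_rescale]
      simp
  rw [hrescale, coeff_rescale, coeff_exp]
  simp [div_eq_mul_inv]

lemma coeff_expUnit_add_inv_sub_two (j : ℕ) :
    coeff j ((expUnit : ℚ⟦X⟧) + (↑expUnit⁻¹ : ℚ⟦X⟧) - 2) =
      (1 + (-1 : ℚ) ^ j) / j.factorial - if j = 0 then 2 else 0 := by
  have hexp := coeff_expUnit_zpow 1 j
  have hinv := coeff_expUnit_zpow (-1) j
  rw [zpow_one, Int.cast_one, one_pow] at hexp
  rw [zpow_neg_one, Int.cast_neg, Int.cast_one] at hinv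
  rw [map_sub, map_add, hexp, hinv, ← add_div, ← map_ofNat C 2, coeff_C]

lemma expUnit_add_inv_sub_two_mem_coeffsIn :
    (expUnit : ℚ⟦X⟧) + (↑expUnit⁻¹ : ℚ⟦X⟧) - 2 ∈ coeffsIn (Subsemiring.nonneg ℚ) := fun j => by
  rw [Subsemiring.mem_nonneg, coeff_expUnit_add_inv_sub_two]
  split_ifs with h
  · subst h; norm_num
  · rw [sub_zero]
    refine div_nonneg ?_ (by positivity)
    rcases neg_one_pow_eq_or ℚ j with h | h <;> rw [h] <;> norm_num

lemma rankMoment_eq_sum (j n : ℕ) : rankMoment j n = ∑ p : n.Partition, rank p ^ j := by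
  refine sum_pow_mul_card_fiber (fun p => ?_) j
  have hsup := sup_parts_le p
  have hcard := card_parts_le p
  rw [rank, mem_Icc]
  omega

lemma crankMoment_eq_sum (j : ℕ) {n : ℕ} (hn : n ≠ 1) :
    crankMoment j n = ∑ p : n.Partition, crank p ^ j := by
  simp only [crankMoment, crankCount, if_neg hn]
  refine sum_pow_mul_card_fiber (fun p => ?_) j
  have hsup := sup_parts_le p
  have hcard := card_parts_le p
  have hcount := Multiset.count_le_card 1 p.parts
  have hcountP := Multiset.countP_le_card (fun i => p.parts.count 1 < i) p.parts
  rw [crank, mem_Icc]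
  split_ifs <;> omega

lemma rankMoment_one {j : ℕ} (hj : j ≠ 0) : rankMoment j 1 = 0 := by
  simp [rankMoment_eq_sum, rank, hj]

lemma crankMoment_one {j : ℕ} (hj : Even j) (hj0 : j ≠ 0) : crankMoment j 1 = 2 := by
  have hIcc : Icc (-((1 : ℕ) : ℤ)) ((1 : ℕ) : ℤ) = {-1, 0, 1} := by decide
  rw [crankMoment, hIcc]
  simp [crankCount, hj.neg_pow, hj0]

theorem rankMoment_add_two_le_crankMoment {j n : ℕ} (hj : Even j) (hj0 : j ≠ 0) (hn : n ≠ 0) :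
    rankMoment j n + 2 ≤ crankMoment j n := by
  rcases eq_or_ne n 1 with rfl | hn1
  · rw [rankMoment_one hj0, crankMoment_one hj hj0, zero_add]
  have hcoeff := sum_zpow_crank_sub_sum_zpow_rank_sub_mem expUnit_add_inv_sub_two_mem_coeffsIn
    (show 2 ≤ n by omega) j
  simp only [Subsemiring.mem_nonneg, map_sub _ (_ - _), map_sub _ (∑ _, _), map_sum,
    coeff_expUnit_zpow, coeff_expUnit_add_inv_sub_two, if_neg hj0, hj.neg_one_pow] at hcoeff
  have hfac : (0 : ℚ) < j.factorial := by positivity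
  rw [← sum_div, ← sum_div, sub_zero, ← sub_div, ← sub_div, le_div_iff₀ hfac, zero_mul] at hcoeff
  rw [rankMoment_eq_sum, crankMoment_eq_sum j hn1, ← Int.cast_le (R := ℚ)]
  push_cast
  linarith

end Moments

end PartitionMoments

theorem mainTheorem2 (k n : ℕ) (hk : 1 ≤ k) (hn : 1 ≤ n) :
    PartitionMoments.rankMoment (2 * k) n < PartitionMoments.crankMoment (2 * k) n := by
  have hle := PartitionMoments.rankMoment_add_two_le_crankMoment (even_two_mul k)
    (show 2 * k ≠ 0 by omega) (show n ≠ 0 by omega)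
  omega
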